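/- Let $\mathcal H$ be a real Hilbert space. Let $f,h:\mathcal H\to\mathbb R$ be convex and differentiable with $\nabla f$ $(1/\beta_f)$-Lipschitz and $\nabla h$ $(1/\beta)$-Lipschitz, where $\beta_f,\beta>0$, and let $g:\mathcal H\to(-\infty,\infty]$ be closed (lower semicontinuous), proper and convex. Put $A=\partial f$, $B=\partial g$, $C=\nabla h$, let $J_S=(I+S)^{-1}$ denote the resolvent of a maximal monotone operator $S$, let $\gamma\in(0,2\beta)$, and let $$T=I-J_{\gamma B}+J_{\gamma A}\circ(2J_{\gamma B}-I-\gamma\, C\circ J_{\gamma B}).$$ Let $\alpha=2\beta/(4\beta-\gamma)$ and let $(\lambda_j)_{j\ge0}\subseteq(0,1/\alpha)$ satisfy $\underline\tau:=\inf_{j\ge0}\lambda_j(1-\alpha\lambda_j)/\alpha>0$. For an arbitrary $z^0\in\mathcal H$ let $z^{k+1}=(1-\lambda_k)z^k+\lambda_kTz^k$ and $x_g^k=J_{\gamma B}(z^k)$ for $k\ge0$. Let $z^*$ be any fixed point of $T$ and let $x^*=J_{\gamma B}(z^*)$. Then $g(x^*)$ and all $g(x_g^i)$ are finite, $$0\le\min_{i=0,\dots,k}\bigl\{(f+g+h)(x_g^i)-(f+g+h)(x^*)\bigr\}\quad\text{for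 all }k\ge0,$$ and $$\min_{i=0,\dots,k}\bigl\{(f+g+h)(x_g^i)-(f+g+h)(x^*)\bigr\}=o\!\left(\frac1{k+1}\right)\quad\text{as }k\to\infty.$$ -/

import Mathlib

open Filter Asymptotics

noncomputable section

namespace DavisYin

variable {H : Type*} [NormedAddCommGroup H] [InnerProductSpace ℝ H]

/-- A closed (lower semicontinuous), proper, convex function `H → (-∞, ∞]`, as an
`EReal`-valued function; convexity is convexity of the epigraph. -/
structure IsClosedProperConvex (g : H → EReal) : Prop where
  ne_bot : ∀ x, g x ≠ ⊥
  exists_ne_top : ∃ x, g x ≠ ⊤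
  lsc : LowerSemicontinuous g
  convex_epigraph : Convex ℝ {p : H × ℝ | g p.1 ≤ (p.2 : EReal)}

/-- The convex subdifferential `∂f(x) = {u | ∀ y, f(y) ≥ f(x) + ⟨y - x, u⟩}`. -/
def subdifferential (f : H → EReal) (x : H) : Set H :=
  {u | ∀ y, f x + ((inner ℝ (y - x) u : ℝ) : EReal) ≤ f y}

/-- The scalar multiple `γ S` of a set-valued operator `S`. -/
def scaled (γ : ℝ) (S : H → Set H) (x : H) : Set H :=
  (fun u => γ • u) '' S x

/-- The resolvent `J_S = (I + S)⁻¹` of a set-valued operator: `resolvent S z` is a point `x` with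
`z ∈ x + S x`. For maximal monotone `S`, such as a positive multiple of the subdifferential of a
closed proper convex function on a Hilbert space, there is exactly one such point. -/
def resolvent (S : H → Set H) (z : H) : H :=
  Classical.epsilon fun x => ∃ u ∈ S x, x + u = z

/-- The operator `T = I - J_{γB} + J_{γA} ∘ (2 J_{γB} - I - γ C ∘ J_{γB})`. -/
def splittingOperator (γ : ℝ) (A B : H → Set H) (C : H → H) (z : H) : H :=
  z - resolvent (scaled γ B) z
    + resolvent (scaled γ A)
        ((2 : ℝ) • resolvent (scaled γ B) z - z - γ • C (resolvent (scaled γ B) z))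

/-- The relaxed iteration `z^{k+1} = (1 - λ_k) z^k + λ_k T z^k` started at `z0`. -/
def relaxedIterate (T : H → H) (lam : ℕ → ℝ) (z0 : H) : ℕ → H
  | 0 => z0
  | k + 1 => (1 - lam k) • relaxedIterate T lam z0 k + lam k • T (relaxedIterate T lam z0 k)

/-- The objective `f + g + h`, for real-valued `f`, `h` and extended-real-valued `g`. -/
def objective (f : H → ℝ) (g : H → EReal) (h : H → ℝ) (x : H) : EReal :=
  (f x : EReal) + g x + (h x : EReal)

/-- The running minimum `min_{i = 0, …, k} a i`. -/
def runningMin (a : ℕ → ℝ) (k : ℕ) : ℝ :=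
  (Finset.range (k + 1)).inf' Finset.nonempty_range_add_one a

end DavisYin

end

namespace DavisYin

/-! ### Existence of proximal points. -/

section ProximalPoint

variable {H : Type*} [NormedAddCommGroup H] [InnerProductSpace ℝ H]

/-! Let `w = z - T z` and `S = ⟪z - zstar, w⟫` along the iteration. With `xf` the second proximal
point, `w = xg - xf = γ (ug + ∇f(xf) + ∇h(xg))`, where `ug ∈ ∂g(xg)`. Monotonicity of `∂g` and `∇f`
and cocoercivity of `∇h` give `‖w‖² ≤ 2αS` (`mul_norm_sq_le_inner_add_smul`). So `‖z - zstar‖²`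
drops by at least `2ατS` per step, and `S` is summable.

The objective gap is nonnegative by optimality of `xstar`. Convexity, plus the descent lemma to move
`f` from `xf` to `xg`, bounds it by `⟪xg - xstar, w⟫/γ + ‖w‖²/(2βf)`, which is at most a multiple of
`S` (`inner_le_two_mul_inner_add_smul`). The gap is thus summable, and `runningMin_isLittleO` gives
the rate. -/

theorem IsClosedProperConvex.isClosed_epigraph {g : H → EReal} (hg : IsClosedProperConvex g) :
    IsClosed {p : H × ℝ | g p.1 ≤ (p.2 : EReal)} := by
  have h := hg.lsc.isClosed_epigraph
  exact h.preimage (f := fun p : H × ℝ => (p.1, (p.2 : EReal)))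
    (continuous_fst.prodMk (continuous_coe_real_ereal.comp continuous_snd))

theorem IsClosedProperConvex.exists_affine_minorant {g : H → EReal}
    (hg : IsClosedProperConvex g) :
    ∃ (l : H →L[ℝ] ℝ) (b : ℝ), ∀ x (t : ℝ), g x ≤ t → b - l x ≤ t := by
  obtain ⟨x₀, hx₀⟩ := hg.exists_ne_top
  obtain ⟨t₀, ht₀⟩ : ∃ t : ℝ, g x₀ = t := ⟨_, (EReal.coe_toReal hx₀ (hg.ne_bot x₀)).symm⟩
  have hnot : (x₀, t₀ - 1) ∉ {p : H × ℝ | g p.1 ≤ (p.2 : EReal)} := by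
    simp only [Set.mem_ofPred_eq, ht₀, EReal.coe_le_coe_iff]
    linarith
  obtain ⟨F, s, hs, hF⟩ :=
    geometric_hahn_banach_point_closed hg.convex_epigraph hg.isClosed_epigraph hnot
  have hsplit : ∀ (x : H) (t : ℝ), F (x, t) = F (x, 0) + t * F (0, 1) := by
    intro x t
    have : ((x, t) : H × ℝ) = (x, 0) + t • ((0, 1) : H × ℝ) := by simp
    rw [this, map_add, map_smul, smul_eq_mul]
  set a := F (0, 1) with ha
  have h1 := hF (x₀, t₀) (by simp [ht₀])
  rw [hsplit] at hs h1
  -- The separated point lies directly below the graph, so the hyperplane is not vertical.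
  have ha0 : 0 < a := by nlinarith
  refine ⟨a⁻¹ • F.comp (ContinuousLinearMap.inl ℝ H ℝ), a⁻¹ * s, fun x t hxt => ?_⟩
  have h2 := hF (x, t) hxt
  rw [hsplit] at h2
  have h3 : (a⁻¹ • F.comp (ContinuousLinearMap.inl ℝ H ℝ)) x = a⁻¹ * F (x, 0) := by simp
  rw [h3, ← mul_sub, inv_mul_le_iff₀ ha0]
  linarith

/-- A closed convex subset of `H × ℝ` that lies above an affine function contains a minimizer of
`(x, t) ↦ t + c ‖x - z‖²`. -/
theorem exists_forall_add_mul_norm_sub_sq_le [CompleteSpace H] {E : Set (H × ℝ)}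
    (hne : E.Nonempty) (hconv : Convex ℝ E) (hclosed : IsClosed E) (l : H →L[ℝ] ℝ) (b : ℝ)
    (hb : ∀ p ∈ E, b - l p.1 ≤ p.2) {c : ℝ} (hc : 0 < c) (z : H) :
    ∃ p ∈ E, ∀ p' ∈ E, p.2 + c * ‖p.1 - z‖ ^ 2 ≤ p'.2 + c * ‖p'.1 - z‖ ^ 2 := by
  set q : H × ℝ → ℝ := fun p => p.2 + c * ‖p.1 - z‖ ^ 2 with hq
  have hbdd : BddBelow (q '' E) := by
    refine ⟨b - l z - ‖l‖ ^ 2 / (4 * c), ?_⟩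
    rintro _ ⟨p, hp, rfl⟩
    have h1 := hb p hp
    have h2 : l (p.1 - z) ≤ ‖l‖ * ‖p.1 - z‖ := (le_abs_self _).trans (l.le_opNorm _)
    rw [map_sub] at h2
    have h3 : ‖l‖ ^ 2 / (4 * c) + c * ‖p.1 - z‖ ^ 2 - ‖l‖ * ‖p.1 - z‖
        = (‖l‖ - 2 * c * ‖p.1 - z‖) ^ 2 / (4 * c) := by field_simp; ring
    have h4 : 0 ≤ (‖l‖ - 2 * c * ‖p.1 - z‖) ^ 2 / (4 * c) := by positivity
    simp only [hq]
    linarith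
  set I := sInf (q '' E) with hI
  have hIle : ∀ p ∈ E, I ≤ q p := fun p hp => csInf_le hbdd ⟨p, hp, rfl⟩
  have hseq : ∀ n : ℕ, ∃ p ∈ E, q p < I + 1 / ((n : ℝ) + 1) := by
    intro n
    have hpos : (0 : ℝ) < 1 / ((n : ℝ) + 1) := by positivity
    obtain ⟨_, ⟨p, hp, rfl⟩, h⟩ :=
      exists_lt_of_csInf_lt (hne.image q) (show sInf (q '' E) < I + 1 / ((n : ℝ) + 1) by linarith)
    exact ⟨p, hp, h⟩
  choose p hpE hp using hseq
  -- Midpoints stay in `E`; the parallelogram law then makes minimizing sequences Cauchy in the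
  -- first coordinate.
  have hmid : ∀ m n, c / 4 * ‖(p m).1 - (p n).1‖ ^ 2 ≤ (q (p m) + q (p n)) / 2 - I := by
    intro m n
    have h1 := hIle _ (hconv (hpE m) (hpE n) (by norm_num : (0 : ℝ) ≤ 1 / 2)
      (by norm_num : (0 : ℝ) ≤ 1 / 2) (by norm_num))
    have h2 : ((1 / 2 : ℝ) • p m + (1 / 2 : ℝ) • p n).1 - z
        = (1 / 2 : ℝ) • (((p m).1 - z) + ((p n).1 - z)) := by
      simp only [Prod.fst_add, Prod.smul_fst]; module
    have h3 : (p m).1 - (p n).1 = ((p m).1 - z) - ((p n).1 - z) := by abel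
    have h4 := parallelogram_law_with_norm ℝ ((p m).1 - z) ((p n).1 - z)
    rw [← h3] at h4
    simp only [hq, h2, norm_smul, Prod.snd_add, Prod.smul_snd, smul_eq_mul] at h1 ⊢
    norm_num at h1
    nlinarith
  have hcau : CauchySeq fun n => (p n).1 := by
    refine cauchySeq_of_le_tendsto_0 (fun N : ℕ => √(4 / c * (1 / ((N : ℝ) + 1)))) ?_ ?_
    · intro m n N hm hn
      rw [dist_eq_norm]
      apply Real.le_sqrt_of_sq_le
      have h1 : 1 / ((m : ℝ) + 1) ≤ 1 / ((N : ℝ) + 1) := by gcongr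
      have h2 : 1 / ((n : ℝ) + 1) ≤ 1 / ((N : ℝ) + 1) := by gcongr
      have h3 : c / 4 * ‖(p m).1 - (p n).1‖ ^ 2 ≤ 1 / ((N : ℝ) + 1) := by
        linarith [hmid m n, hp m, hp n]
      calc ‖(p m).1 - (p n).1‖ ^ 2 = 4 / c * (c / 4 * ‖(p m).1 - (p n).1‖ ^ 2) := by field_simp
        _ ≤ _ := by gcongr
    · have := ((tendsto_one_div_add_atTop_nhds_zero_nat (𝕜 := ℝ)).const_mul (4 / c)).sqrt
      simpa using this
  obtain ⟨x, hx⟩ := cauchySeq_tendsto_of_complete hcau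
  have hqlim : Tendsto (fun n => q (p n)) atTop (nhds I) := by
    refine tendsto_of_tendsto_of_tendsto_of_le_of_le tendsto_const_nhds ?_
      (fun n => hIle _ (hpE n)) (fun n => (hp n).le)
    simpa using (tendsto_one_div_add_atTop_nhds_zero_nat (𝕜 := ℝ)).const_add I
  have htlim : Tendsto (fun n => (p n).2) atTop (nhds (I - c * ‖x - z‖ ^ 2)) := by
    have := hqlim.sub (((hx.sub_const z).norm.pow 2).const_mul c)
    simpa [hq] using this
  refine ⟨(x, I - c * ‖x - z‖ ^ 2), hclosed.mem_of_tendsto (hx.prodMk_nhds htlim)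
    (Eventually.of_forall hpE), fun p' hp' => ?_⟩
  have := hIle p' hp'
  simp only [hq] at this
  simpa using this

theorem nonneg_of_forall_add_mul_nonneg {a b : ℝ}
    (h : ∀ θ : ℝ, 0 < θ → θ < 1 → 0 ≤ a + θ * b) : 0 ≤ a := by
  have hlim : Tendsto (fun θ : ℝ => a + θ * b) (nhdsWithin 0 (Set.Ioi 0)) (nhds a) := by
    have : Tendsto (fun θ : ℝ => a + θ * b) (nhds 0) (nhds (a + 0 * b)) :=
      (continuous_const.add (continuous_id.mul continuous_const)).tendsto 0
    simp only [zero_mul, add_zero] at this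
    exact this.mono_left nhdsWithin_le_nhds
  refine ge_of_tendsto hlim ?_
  filter_upwards [Ioo_mem_nhdsGT (zero_lt_one (α := ℝ))] with θ hθ
  exact h θ hθ.1 hθ.2

/-- The point is the minimizer of `g + ‖· - z‖²/(2γ)`, found on the epigraph to avoid `EReal`
arithmetic. Since `resolvent` is an epsilon choice, existence suffices; uniqueness is never needed.
-/
theorem IsClosedProperConvex.exists_resolvent [CompleteSpace H] {g : H → EReal}
    (hg : IsClosedProperConvex g) {γ : ℝ} (hγ : 0 < γ) (z : H) :
    ∃ x, ∃ u ∈ scaled γ (subdifferential g) x, x + u = z := by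
  obtain ⟨l, b, hb⟩ := hg.exists_affine_minorant
  obtain ⟨x₀, hx₀⟩ := hg.exists_ne_top
  obtain ⟨⟨x, t⟩, hxt, hmin⟩ := exists_forall_add_mul_norm_sub_sq_le
    (E := {p : H × ℝ | g p.1 ≤ (p.2 : EReal)}) ⟨(x₀, (g x₀).toReal), EReal.le_coe_toReal hx₀⟩
    hg.convex_epigraph hg.isClosed_epigraph l b (fun p hp => hb p.1 p.2 hp)
    (c := 1 / (2 * γ)) (by positivity) z
  refine ⟨x, z - x, ⟨γ⁻¹ • (z - x), fun y => ?_, by simp [smul_smul, hγ.ne']⟩, by abel⟩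
  by_cases hy : g y = ⊤
  · simp [hy]
  obtain ⟨s, hs⟩ : ∃ s : ℝ, g y = s := ⟨_, (EReal.coe_toReal hy (hg.ne_bot y)).symm⟩
  -- Compare the minimizer with points of the segment towards `(y, s)`, divide by `θ` and let `θ →
  -- 0`.
  have key : 0 ≤ (s - t) - inner ℝ (y - x) (γ⁻¹ • (z - x)) := by
    refine nonneg_of_forall_add_mul_nonneg (b := 1 / (2 * γ) * ‖y - x‖ ^ 2) fun θ h0 h1 => ?_
    have hmem := hg.convex_epigraph hxt (show (y, s) ∈ _ from hs.le)
      (by linarith : 0 ≤ 1 - θ) h0.le (by ring)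
    have h2 := hmin _ hmem
    have h3 : ((1 - θ) • ((x, t) : H × ℝ) + θ • ((y, s) : H × ℝ)).1 - z
        = θ • (y - x) - (z - x) := by
      simp only [Prod.fst_add, Prod.smul_fst]; module
    rw [h3, norm_sub_sq_real (θ • (y - x)), norm_smul, inner_smul_left, norm_sub_rev x z] at h2
    simp only [Prod.snd_add, Prod.smul_snd, smul_eq_mul, Real.norm_eq_abs, abs_of_pos h0,
      conj_trivial] at h2
    rw [inner_smul_right]
    have h4 : 0 ≤ θ * ((s - t) - γ⁻¹ * inner ℝ (y - x) (z - x)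
        + θ * (1 / (2 * γ) * ‖y - x‖ ^ 2)) := by
      have h5 : 1 / (2 * γ) * ((θ * ‖y - x‖) ^ 2 - 2 * (θ * inner ℝ (y - x) (z - x))
          + ‖z - x‖ ^ 2) = θ * (θ * (1 / (2 * γ) * ‖y - x‖ ^ 2))
          - θ * (γ⁻¹ * inner ℝ (y - x) (z - x)) + 1 / (2 * γ) * ‖z - x‖ ^ 2 := by
        field_simp
      rw [h5] at h2
      linarith
    exact nonneg_of_mul_nonneg_right h4 h0
  calc g x + ((inner ℝ (y - x) (γ⁻¹ • (z - x)) : ℝ) : EReal)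
      ≤ (t : EReal) + ((inner ℝ (y - x) (γ⁻¹ • (z - x)) : ℝ) : EReal) := add_le_add_left hxt _
    _ ≤ g y := by rw [hs, ← EReal.coe_add, EReal.coe_le_coe_iff]; linarith

/-- The point `x = J_{γ ∂g} z` satisfies `z = x + γ u` for some `u ∈ ∂g(x)`. -/
theorem IsClosedProperConvex.exists_mem_subdifferential_resolvent [CompleteSpace H]
    {g : H → EReal} (hg : IsClosedProperConvex g) {γ : ℝ} (hγ : 0 < γ) (z : H) :
    ∃ u ∈ subdifferential g (resolvent (scaled γ (subdifferential g)) z),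
      z = resolvent (scaled γ (subdifferential g)) z + γ • u := by
  obtain ⟨_, ⟨u, hu, rfl⟩, h⟩ := Classical.epsilon_spec (hg.exists_resolvent hγ z)
  exact ⟨u, hu, h.symm⟩

theorem IsClosedProperConvex.ne_top_of_mem_subdifferential {g : H → EReal}
    (hg : IsClosedProperConvex g) {x u : H} (hu : u ∈ subdifferential g x) : g x ≠ ⊤ := by
  intro h
  obtain ⟨y, hy⟩ := hg.exists_ne_top
  have := hu y
  rw [h, EReal.top_add_coe, top_le_iff] at this
  exact hy this

theorem IsClosedProperConvex.toReal_add_inner_le {g : H → EReal}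
    (hg : IsClosedProperConvex g) {x y u : H} (hu : u ∈ subdifferential g x) (hy : g y ≠ ⊤) :
    (g x).toReal + inner ℝ (y - x) u ≤ (g y).toReal := by
  have h := hu y
  rwa [← EReal.coe_toReal (hg.ne_top_of_mem_subdifferential hu) (hg.ne_bot x),
    ← EReal.coe_toReal hy (hg.ne_bot y), ← EReal.coe_add, EReal.coe_le_coe_iff] at h

theorem isClosedProperConvex_coe {f : H → ℝ} (hf : ConvexOn ℝ Set.univ f) (hc : Continuous f) :
    IsClosedProperConvex fun x => (f x : EReal) where
  ne_bot x := EReal.coe_ne_bot _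
  exists_ne_top := ⟨0, EReal.coe_ne_top _⟩
  lsc := (continuous_coe_real_ereal.comp hc).lowerSemicontinuous
  convex_epigraph := by
    have := hf.convex_epigraph
    simpa only [EReal.coe_le_coe_iff, Set.mem_univ, true_and] using this

end ProximalPoint

/-! ### Convex functions with Lipschitz gradient. -/

section SmoothConvex

variable {H : Type*} [NormedAddCommGroup H] [InnerProductSpace ℝ H] [CompleteSpace H] {f : H → ℝ}

theorem hasDerivAt_comp_add_smul (hd : Differentiable ℝ f) (x v : H) (t : ℝ) :
    HasDerivAt (fun s : ℝ => f (x + s • v)) (inner ℝ (gradient f (x + t • v)) v) t := by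
  have h1 : HasDerivAt (fun s : ℝ => x + s • v) v t := by
    simpa using ((hasDerivAt_id t).smul_const v).const_add x
  have h2 := (hd (x + t • v)).hasFDerivAt.comp_hasDerivAt t h1
  rwa [← inner_gradient_left] at h2

theorem add_inner_gradient_le (hf : ConvexOn ℝ Set.univ f) (hd : Differentiable ℝ f) (x y : H) :
    f x + inner ℝ (gradient f x) (y - x) ≤ f y := by
  have hline : ConvexOn ℝ Set.univ fun t : ℝ => f (x + t • (y - x)) := by
    have := hf.comp_affineMap (AffineMap.lineMap x y : ℝ →ᵃ[ℝ] H)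
    simpa [Function.comp_def, AffineMap.lineMap_apply, add_comm] using this
  have h := hline.le_slope_of_hasDerivAt (Set.mem_univ 0) (Set.mem_univ 1) one_pos
    (hasDerivAt_comp_add_smul hd x (y - x) 0)
  simp only [slope_def_field, zero_smul, add_zero, one_smul, add_sub_cancel, sub_zero,
    div_one] at h
  linarith

theorem eq_gradient_of_mem_subdifferential (hd : Differentiable ℝ f) {x u : H}
    (hu : u ∈ subdifferential (fun x => (f x : EReal)) x) : u = gradient f x := by
  have h : ∀ y, f x + inner ℝ (y - x) u ≤ f y := fun y => by
    have := hu y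
    rwa [← EReal.coe_add, EReal.coe_le_coe_iff] at this
  set v := gradient f x - u with hv
  -- Along `v`, `f` minus its linear minorant is minimal at `0` with slope `‖v‖²`, so `v = 0`.
  have hder : HasDerivAt (fun s : ℝ => f (x + s • v) - s * inner ℝ v u) (inner ℝ v v) 0 := by
    have h1 := (hasDerivAt_comp_add_smul hd x v 0).sub
      ((hasDerivAt_id (0 : ℝ)).mul_const (inner ℝ v u))
    have h2 : inner ℝ v v = inner ℝ (gradient f x) v - inner ℝ v u := by
      rw [real_inner_comm u v, ← inner_sub_left]
    rw [zero_smul, add_zero, one_mul, ← h2] at h1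
    exact h1
  have hmin : IsLocalMin (fun s : ℝ => f (x + s • v) - s * inner ℝ v u) 0 := by
    refine Eventually.of_forall fun s => ?_
    have := h (x + s • v)
    simp only [add_sub_cancel_left, inner_smul_left, conj_trivial] at this
    simp only [zero_smul, add_zero, zero_mul, sub_zero]
    linarith
  have := hmin.hasDerivAt_eq_zero hder
  rw [inner_self_eq_zero, hv, sub_eq_zero] at this
  exact this.symm

/-- The descent lemma for a function with Lipschitz gradient. -/
theorem le_add_inner_gradient_add (hd : Differentiable ℝ f) {L : ℝ}
    (hL : ∀ x y, ‖gradient f x - gradient f y‖ ≤ L * ‖x - y‖) (x y : H) :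
    f y ≤ f x + inner ℝ (gradient f x) (y - x) + L / 2 * ‖y - x‖ ^ 2 := by
  set v := y - x with hv
  set φ : ℝ → ℝ := fun t =>
    f (x + t • v) - t * inner ℝ (gradient f x) v - t ^ 2 * (L / 2 * ‖v‖ ^ 2) with hφ
  have hder : ∀ t, HasDerivAt φ (inner ℝ (gradient f (x + t • v)) v
      - 1 * inner ℝ (gradient f x) v - (2 * t) * (L / 2 * ‖v‖ ^ 2)) t := by
    intro t
    have h2 : HasDerivAt (fun t : ℝ => t ^ 2) (2 * t) t := by simpa using hasDerivAt_pow 2 t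
    exact ((hasDerivAt_comp_add_smul hd x v t).sub
      ((hasDerivAt_id t).mul_const _)).sub (h2.mul_const _)
  have hanti : AntitoneOn φ (Set.Icc 0 1) := by
    refine antitoneOn_of_deriv_nonpos (convex_Icc 0 1)
      (fun t _ => (hder t).continuousAt.continuousWithinAt)
      (fun t _ => (hder t).differentiableAt.differentiableWithinAt) fun t ht => ?_
    rw [interior_Icc] at ht
    rw [(hder t).deriv, one_mul, ← inner_sub_left]
    have h1 := real_inner_le_norm (gradient f (x + t • v) - gradient f x) v
    have h2 := hL (x + t • v) x
    rw [add_sub_cancel_left, norm_smul, Real.norm_eq_abs, abs_of_pos ht.1] at h2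
    have h3 := mul_le_mul_of_nonneg_right h2 (norm_nonneg v)
    nlinarith
  have h := hanti (Set.left_mem_Icc.2 zero_le_one) (Set.right_mem_Icc.2 zero_le_one) zero_le_one
  simp only [hφ, one_smul, zero_smul, hv, add_sub_cancel, add_zero] at h
  linarith

/-- Evaluate the tangent bound at `x` and the descent bound at `y` at the point `y - β • d`, a step
of length `β` along the gradient difference `d`. -/
theorem add_inner_gradient_add_sq_le (hf : ConvexOn ℝ Set.univ f) (hd : Differentiable ℝ f)
    {β : ℝ} (hβ : 0 < β)
    (hL : ∀ x y, ‖gradient f x - gradient f y‖ ≤ 1 / β * ‖x - y‖) (x y : H) :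
    f x + inner ℝ (gradient f x) (y - x) + β / 2 * ‖gradient f y - gradient f x‖ ^ 2 ≤ f y := by
  set d := gradient f y - gradient f x with hd'
  have h1 := add_inner_gradient_le hf hd x (y - β • d)
  have h2 := le_add_inner_gradient_add hd hL y (y - β • d)
  rw [sub_sub_cancel_left, inner_neg_right, norm_neg, norm_smul, inner_smul_right,
    Real.norm_eq_abs, abs_of_pos hβ] at h2
  rw [sub_right_comm, inner_sub_right, inner_smul_right] at h1
  have h3 : inner ℝ (gradient f y) d - inner ℝ (gradient f x) d = ‖d‖ ^ 2 := by
    rw [← inner_sub_left, ← hd', real_inner_self_eq_norm_sq]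
  have h4 : 1 / β / 2 * (β * ‖d‖) ^ 2 = β / 2 * ‖d‖ ^ 2 := by field_simp
  rw [h4] at h2
  have h5 := congrArg (β * ·) h3
  simp only [mul_sub] at h5
  linarith

/-- The Baillon–Haddad theorem: the gradient is cocoercive. -/
theorem mul_norm_gradient_sub_sq_le_inner (hf : ConvexOn ℝ Set.univ f) (hd : Differentiable ℝ f)
    {β : ℝ} (hβ : 0 < β)
    (hL : ∀ x y, ‖gradient f x - gradient f y‖ ≤ 1 / β * ‖x - y‖) (x y : H) :
    β * ‖gradient f x - gradient f y‖ ^ 2 ≤ inner ℝ (gradient f x - gradient f y) (x - y) := by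
  have h1 := add_inner_gradient_add_sq_le hf hd hβ hL x y
  have h2 := add_inner_gradient_add_sq_le hf hd hβ hL y x
  rw [norm_sub_rev] at h1
  rw [← neg_sub x y, inner_neg_right] at h1
  rw [inner_sub_left]
  linarith

end SmoothConvex

/-! ### Running minima of summable sequences. -/

section RunningMin

theorem runningMin_le {a : ℕ → ℝ} {i k : ℕ} (h : i ≤ k) : runningMin a k ≤ a i :=
  Finset.inf'_le _ (Finset.mem_range_succ_iff.2 h)

theorem runningMin_nonneg {a : ℕ → ℝ} (h : ∀ i, 0 ≤ a i) (k : ℕ) : 0 ≤ runningMin a k :=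
  Finset.le_inf' _ _ fun i _ => h i

theorem runningMin_isLittleO {a : ℕ → ℝ} (h0 : ∀ i, 0 ≤ a i) (ha : Summable a) :
    runningMin a =o[atTop] fun k : ℕ => 1 / ((k : ℝ) + 1) := by
  have hhalf : Tendsto (fun k : ℕ => k / 2) atTop atTop :=
    Nat.tendsto_div_const_atTop two_ne_zero
  have htail : Tendsto (fun k : ℕ => 2 * ∑' i, a (i + k / 2)) atTop (nhds 0) := by
    simpa using ((tendsto_sum_nat_add a).comp hhalf).const_mul 2
  rw [isLittleO_iff_tendsto' (Eventually.of_forall fun k hk => by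
    have : (0 : ℝ) < 1 / ((k : ℝ) + 1) := by positivity
    exact absurd hk this.ne')]
  refine squeeze_zero (fun k => div_nonneg (runningMin_nonneg h0 k) (by positivity))
    (fun k => ?_) htail
  -- The indices `k / 2, …, k` make up at least half of `0, …, k`, and their sum is bounded by a
  -- vanishing tail.
  have h1 : ((k - k / 2 + 1 : ℕ) : ℝ) * runningMin a k
      ≤ ∑ i ∈ Finset.range (k - k / 2 + 1), a (i + k / 2) := by
    have := Finset.card_nsmul_le_sum (Finset.range (k - k / 2 + 1)) (fun i => a (i + k / 2))
      (runningMin a k) fun i hi => runningMin_le (by have := Finset.mem_range.1 hi; omega)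
    simpa using this
  have h2 : ∑ i ∈ Finset.range (k - k / 2 + 1), a (i + k / 2) ≤ ∑' i, a (i + k / 2) :=
    ((summable_nat_add_iff (k / 2)).2 ha).sum_le_tsum _ fun i _ => h0 _
  have h3 : (k : ℝ) + 1 ≤ 2 * ((k - k / 2 + 1 : ℕ) : ℝ) := by
    have : k + 1 ≤ 2 * (k - k / 2 + 1) := by omega
    exact_mod_cast this
  have h4 := runningMin_nonneg h0 k
  rw [div_div_eq_mul_div, div_one]
  nlinarith

end RunningMin

/-! ### Inner-product estimates for one step. -/

section Estimates

variable {H : Type*} [NormedAddCommGroup H] [InnerProductSpace ℝ H]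

/-- In the application `a = xg - xstar`, `p`, `q`, `r` are the differences of `ug`, `∇f(xf)`,
`∇h(xg)` from their values at the solution, `a + γ • p = z - zstar` and `a - w = xf - xstar`. -/
theorem inner_add_smul_eq {a p q r w : H} {γ : ℝ} (hw : w = γ • (p + q + r)) :
    inner ℝ (a + γ • p) w
      = ‖w‖ ^ 2 + γ * (inner ℝ p a + inner ℝ q (a - w) + inner ℝ r (a - w)) := by
  have h1 : inner ℝ w a = γ * (inner ℝ p a + inner ℝ q a + inner ℝ r a) := by
    rw [hw, inner_smul_left, inner_add_left, inner_add_left, conj_trivial]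
  have h2 : ‖w‖ ^ 2 = γ * (inner ℝ p w + inner ℝ q w + inner ℝ r w) := by
    rw [← real_inner_self_eq_norm_sq]
    nth_rw 1 [hw]
    rw [inner_smul_left, inner_add_left, inner_add_left, conj_trivial]
  rw [inner_add_left, inner_smul_left, conj_trivial, inner_sub_right, inner_sub_right,
    real_inner_comm w a, h1]
  linear_combination -h2

theorem inner_le_mul_sq_add_sq_div (q w : H) {c : ℝ} (hc : 0 < c) :
    |inner ℝ q w| ≤ c * ‖q‖ ^ 2 + ‖w‖ ^ 2 / (4 * c) := by
  refine (abs_real_inner_le_norm q w).trans ?_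
  have h : c * ‖q‖ ^ 2 + ‖w‖ ^ 2 / (4 * c) - ‖q‖ * ‖w‖
      = (2 * c * ‖q‖ - ‖w‖) ^ 2 / (4 * c) := by field_simp; ring
  have : 0 ≤ (2 * c * ‖q‖ - ‖w‖) ^ 2 / (4 * c) := by positivity
  linarith

variable {a p q r w : H} {γ β βf : ℝ}

theorem mul_norm_sq_le_inner_add_smul (hw : w = γ • (p + q + r)) (hγ : 0 < γ) (hβ : 0 < β)
    (hp : 0 ≤ inner ℝ p a) (hq : 0 ≤ inner ℝ q (a - w)) (hr : β * ‖r‖ ^ 2 ≤ inner ℝ r a) :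
    (4 * β - γ) / (4 * β) * ‖w‖ ^ 2 ≤ inner ℝ (a + γ • p) w := by
  rw [inner_add_smul_eq hw, inner_sub_right r]
  have h1 := (le_abs_self _).trans (inner_le_mul_sq_add_sq_div r w hβ)
  have h2 : (4 * β - γ) / (4 * β) * ‖w‖ ^ 2 = ‖w‖ ^ 2 - γ * (‖w‖ ^ 2 / (4 * β)) := by
    field_simp
  have h3 : γ * -(‖w‖ ^ 2 / (4 * β))
      ≤ γ * (inner ℝ p a + inner ℝ q (a - w) + (inner ℝ r a - inner ℝ r w)) :=
    mul_le_mul_of_nonneg_left (by linarith) hγ.le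
  linarith

/-- The second copy of `⟪a + γ • p, w⟫` supplies the cocoercive terms `βf ‖q‖²` and `β ‖r‖²` that
absorb the cross terms `⟪q, w⟫` and `2⟪r, w⟫`. -/
theorem inner_le_two_mul_inner_add_smul (hw : w = γ • (p + q + r)) (hγ : 0 < γ) (hβ : 0 < β)
    (hβf : 0 < βf) (hp : 0 ≤ inner ℝ p a) (hq : βf * ‖q‖ ^ 2 ≤ inner ℝ q (a - w))
    (hr : β * ‖r‖ ^ 2 ≤ inner ℝ r a) :
    inner ℝ a w ≤ 2 * inner ℝ (a + γ • p) w + γ * (1 / β + 1 / (4 * βf)) * ‖w‖ ^ 2 := by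
  have hid := inner_add_smul_eq (a := a) hw
  have hsplit : inner ℝ (a + γ • p) w = inner ℝ a w + γ * inner ℝ p w := by
    rw [inner_add_left, inner_smul_left, conj_trivial]
  have hw2 : ‖w‖ ^ 2 = γ * (inner ℝ p w + inner ℝ q w + inner ℝ r w) := by
    rw [← real_inner_self_eq_norm_sq]
    nth_rw 1 [hw]
    rw [inner_smul_left, inner_add_left, inner_add_left, conj_trivial]
  have h1 := (le_abs_self _).trans (inner_le_mul_sq_add_sq_div q w hβf)
  -- Weight `β / 2`, because `⟪r, w⟫` enters twice.
  have h2 := (le_abs_self _).trans (inner_le_mul_sq_add_sq_div r w (half_pos hβ))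
  rw [inner_sub_right r] at hid
  have h3 : ‖w‖ ^ 2 / (4 * (β / 2)) = 1 / β * ‖w‖ ^ 2 / 2 := by field_simp; norm_num
  have h4 : ‖w‖ ^ 2 / (4 * βf) = 1 / (4 * βf) * ‖w‖ ^ 2 := by ring
  rw [h3] at h2
  rw [h4] at h1
  have h5 : γ * (inner ℝ q w + 2 * inner ℝ r w) ≤ γ * (inner ℝ p a + inner ℝ q (a - w)
      + inner ℝ r a + (1 / β + 1 / (4 * βf)) * ‖w‖ ^ 2) :=
    mul_le_mul_of_nonneg_left (by linarith) hγ.le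
  linarith [sq_nonneg ‖w‖]

end Estimates

/-! ### Summability and the convergence rate. -/

theorem summable_of_forall_mul_le_sub {S V : ℕ → ℝ} {c : ℝ} (hc : 0 < c) (hS : ∀ k, 0 ≤ S k)
    (hV : ∀ k, 0 ≤ V k) (h : ∀ k, c * S k ≤ V k - V (k + 1)) : Summable S := by
  refine summable_of_sum_range_le (c := V 0 / c) hS fun n => ?_
  rw [le_div_iff₀' hc, Finset.mul_sum]
  calc ∑ k ∈ Finset.range n, c * S k ≤ ∑ k ∈ Finset.range n, (V k - V (k + 1)) :=
        Finset.sum_le_sum fun k _ => h k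
    _ = V 0 - V n := Finset.sum_range_sub' V n
    _ ≤ V 0 := sub_le_self _ (hV n)

theorem toReal_objective_sub {H : Type*} {f h : H → ℝ} {g : H → EReal} {x y : H}
    (hx : g x ≠ ⊤) (hx' : g x ≠ ⊥) (hy : g y ≠ ⊤) (hy' : g y ≠ ⊥) :
    (objective f g h x - objective f g h y).toReal
      = (f x + (g x).toReal + h x) - (f y + (g y).toReal + h y) := by
  lift g x to ℝ using ⟨hx, hx'⟩ with s hs
  lift g y to ℝ using ⟨hy, hy'⟩ with t ht
  simp only [objective, ← hs, ← ht, EReal.toReal_coe, ← EReal.coe_add, ← EReal.coe_sub]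

end DavisYin

theorem mainTheorem9 {H : Type*} [NormedAddCommGroup H] [InnerProductSpace ℝ H] [CompleteSpace H]
    (f : H → ℝ) (g : H → EReal) (h : H → ℝ) (β βf γ α : ℝ) (lam : ℕ → ℝ) (z0 zstar xstar : H)
    (T : H → H) (z xg : ℕ → H)
    -- `f`, `g`, `h` are closed, proper and convex, and `∇f`, `∇h` exist and are Lipschitz
    (hf_convex : ConvexOn ℝ Set.univ f) (hf_diff : Differentiable ℝ f) (hβf : 0 < βf)
    (hf_lip : ∀ x y, ‖gradient f x - gradient f y‖ ≤ (1 / βf) * ‖x - y‖)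
    (hg : DavisYin.IsClosedProperConvex g)
    (hh_convex : ConvexOn ℝ Set.univ h) (hh_diff : Differentiable ℝ h) (hβ : 0 < β)
    (hh_lip : ∀ x y, ‖gradient h x - gradient h y‖ ≤ (1 / β) * ‖x - y‖)
    -- step size and relaxation parameters
    (hγ : γ ∈ Set.Ioo 0 (2 * β)) (hα : α = 2 * β / (4 * β - γ))
    (hlam : ∀ j, lam j ∈ Set.Ioo 0 ((4 * β - γ) / (2 * β)))
    (hτ : 0 < ⨅ j, lam j * (1 - α * lam j) / α)
    -- the splitting operator with `A = ∂f`, `B = ∂g`, `C = ∇h`, and its iterates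
    (hT : T = DavisYin.splittingOperator γ (DavisYin.subdifferential fun x => (f x : EReal))
      (DavisYin.subdifferential g) (gradient h))
    (hz : z = DavisYin.relaxedIterate T lam z0)
    (hxg : ∀ k, xg k =
      DavisYin.resolvent (DavisYin.scaled γ (DavisYin.subdifferential g)) (z k))
    -- a fixed point of `T` and the corresponding solution
    (hzstar : T zstar = zstar)
    (hxstar : xstar = DavisYin.resolvent (DavisYin.scaled γ (DavisYin.subdifferential g)) zstar) :
    g xstar ≠ ⊤ ∧ (∀ i, g (xg i) ≠ ⊤) ∧
      (∀ k, 0 ≤ DavisYin.runningMin (fun i =>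
        (DavisYin.objective f g h (xg i) - DavisYin.objective f g h xstar).toReal) k) ∧
      (DavisYin.runningMin fun i =>
        (DavisYin.objective f g h (xg i) - DavisYin.objective f g h xstar).toReal)
        =o[atTop] fun k : ℕ => 1 / ((k : ℝ) + 1) := by

  obtain ⟨hγ0, hγ2⟩ := hγ
  have hf' := DavisYin.isClosedProperConvex_coe hf_convex hf_diff.continuous
  -- the two proximal steps that make up one application of `T`
  have hstep : ∀ y, ∃ xf ug,
      ug ∈ DavisYin.subdifferential g
        (DavisYin.resolvent (DavisYin.scaled γ (DavisYin.subdifferential g)) y) ∧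
      y = DavisYin.resolvent (DavisYin.scaled γ (DavisYin.subdifferential g)) y + γ • ug ∧
      y - T y = DavisYin.resolvent (DavisYin.scaled γ (DavisYin.subdifferential g)) y - xf ∧
      y - T y = γ • (ug + gradient f xf + gradient h
        (DavisYin.resolvent (DavisYin.scaled γ (DavisYin.subdifferential g)) y)) := by
    intro y
    obtain ⟨ug, hug, hy⟩ := hg.exists_mem_subdifferential_resolvent hγ0 y
    set x := DavisYin.resolvent (DavisYin.scaled γ (DavisYin.subdifferential g)) y with hx
    obtain ⟨uf, huf, hxf⟩ := hf'.exists_mem_subdifferential_resolvent hγ0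
      ((2 : ℝ) • x - y - γ • gradient h x)
    rw [DavisYin.eq_gradient_of_mem_subdifferential hf_diff huf] at hxf
    have hTy : y - T y = x - DavisYin.resolvent (DavisYin.scaled γ
        (DavisYin.subdifferential fun x => (f x : EReal)))
          ((2 : ℝ) • x - y - γ • gradient h x) := by
      rw [hT, DavisYin.splittingOperator, ← hx]; abel
    set xf := DavisYin.resolvent (DavisYin.scaled γ
        (DavisYin.subdifferential fun x => (f x : EReal)))
          ((2 : ℝ) • x - y - γ • gradient h x)
    refine ⟨xf, ug, hug, hy, hTy, ?_⟩
    have h1 : γ • gradient f xf = (2 : ℝ) • x - y - γ • gradient h x - xf :=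
      eq_sub_of_add_eq' hxf.symm
    have h2 : γ • ug = y - x := eq_sub_of_add_eq' hy.symm
    rw [hTy, smul_add, smul_add, h1, h2]
    module
  obtain ⟨xf', us, hus, hzs, hxf', hopt⟩ := hstep zstar
  rw [hzstar, sub_self, ← hxstar] at hxf' hopt
  rw [← hxstar] at hus hzs
  -- At a fixed point the residual vanishes: both proximal points coincide and the subgradients sum
  -- to zero.
  obtain rfl : xf' = xstar := (sub_eq_zero.1 hxf'.symm).symm
  rename' xf' => xstar
  have hopt' : us + gradient f xstar + gradient h xstar = 0 :=
    (smul_eq_zero.1 hopt.symm).resolve_left hγ0.ne'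
  choose xf ug hug hzk hwx hwu using fun k => hstep (z k)
  simp only [← hxg] at hug hzk hwx hwu
  have hgs := hg.ne_top_of_mem_subdifferential hus
  have hgk := fun k => hg.ne_top_of_mem_subdifferential (hug k)
  have hD : ∀ i, (DavisYin.objective f g h (xg i) - DavisYin.objective f g h xstar).toReal
      = (f (xg i) + (g (xg i)).toReal + h (xg i))
        - (f xstar + (g xstar).toReal + h xstar) := fun i =>
    DavisYin.toReal_objective_sub (hgk i) (hg.ne_bot _) hgs (hg.ne_bot _)
  have hD0 : ∀ i, 0 ≤
      (DavisYin.objective f g h (xg i) - DavisYin.objective f g h xstar).toReal := by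
    intro i
    have h1 := DavisYin.add_inner_gradient_le hf_convex hf_diff xstar (xg i)
    have h2 := hg.toReal_add_inner_le hus (hgk i)
    have h3 := DavisYin.add_inner_gradient_le hh_convex hh_diff xstar (xg i)
    have h4 : inner ℝ us (xg i - xstar) + inner ℝ (gradient f xstar) (xg i - xstar)
        + inner ℝ (gradient h xstar) (xg i - xstar) = 0 := by
      rw [← inner_add_left, ← inner_add_left, hopt', inner_zero_left]
    rw [real_inner_comm] at h2
    rw [hD]
    linarith
  -- increments relative to the fixed point
  set w : ℕ → H := fun k => z k - T (z k) with hw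
  have hwpqr : ∀ k, w k = γ • ((ug k - us) + (gradient f (xf k) - gradient f xstar)
      + (gradient h (xg k) - gradient h xstar)) := by
    intro k
    have : (ug k - us) + (gradient f (xf k) - gradient f xstar)
        + (gradient h (xg k) - gradient h xstar)
        = (ug k + gradient f (xf k) + gradient h (xg k))
          - (us + gradient f xstar + gradient h xstar) := by abel
    rw [this, hopt', sub_zero]
    exact hwu k
  have hza : ∀ k, z k - zstar = (xg k - xstar) + γ • (ug k - us) := by
    intro k
    conv_lhs => rw [hzk k, hzs]
    module
  have hxfa : ∀ k, xf k - xstar = (xg k - xstar) - w k := by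
    intro k
    simp only [hw, hwx k]; abel
  have hp : ∀ k, 0 ≤ inner ℝ (ug k - us) (xg k - xstar) := by
    intro k
    have h1 := hg.toReal_add_inner_le hus (hgk k)
    have h2 := hg.toReal_add_inner_le (hug k) hgs
    rw [← neg_sub, inner_neg_left] at h2
    rw [real_inner_comm, inner_sub_right]
    linarith
  have hq : ∀ k, βf * ‖gradient f (xf k) - gradient f xstar‖ ^ 2
      ≤ inner ℝ (gradient f (xf k) - gradient f xstar) ((xg k - xstar) - w k) := fun k => by
    rw [← hxfa]
    exact DavisYin.mul_norm_gradient_sub_sq_le_inner hf_convex hf_diff hβf hf_lip _ _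
  have hr : ∀ k, β * ‖gradient h (xg k) - gradient h xstar‖ ^ 2
      ≤ inner ℝ (gradient h (xg k) - gradient h xstar) (xg k - xstar) := fun k =>
    DavisYin.mul_norm_gradient_sub_sq_le_inner hh_convex hh_diff hβ hh_lip _ _
  have h4β : 0 < 4 * β - γ := by linarith
  have h4β' : β * 4 - γ ≠ 0 := by rw [mul_comm]; exact h4β.ne'
  have hα0 : 0 < α := by rw [hα]; positivity
  set S : ℕ → ℝ := fun k => inner ℝ (z k - zstar) (w k) with hS
  have hwS : ∀ k, ‖w k‖ ^ 2 ≤ 2 * α * S k := by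
    intro k
    have h1 := DavisYin.mul_norm_sq_le_inner_add_smul (hwpqr k) hγ0 hβ (hp k)
      ((by positivity : (0 : ℝ) ≤ _).trans (hq k)) (hr k)
    rw [← hza] at h1
    have h2 := mul_le_mul_of_nonneg_left h1 (by positivity : 0 ≤ 2 * α)
    have h3 : 2 * α * ((4 * β - γ) / (4 * β) * ‖w k‖ ^ 2) = ‖w k‖ ^ 2 := by
      rw [hα]; field_simp; ring
    rwa [h3] at h2
  have hS0 : ∀ k, 0 ≤ S k := fun k =>
    nonneg_of_mul_nonneg_right ((sq_nonneg _).trans (hwS k)) (by positivity)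
  -- telescoping of the distance to the fixed point
  have hαlam : ∀ j, α * lam j < 1 := by
    intro j
    have := mul_lt_mul_of_pos_left (hlam j).2 hα0
    have h1 : α * ((4 * β - γ) / (2 * β)) = 1 := by rw [hα]; field_simp
    rwa [h1] at this
  set τ := ⨅ j, lam j * (1 - α * lam j) / α with hτdef
  have hτle : ∀ j, τ ≤ lam j * (1 - α * lam j) / α := by
    refine fun j => ciInf_le ⟨0, ?_⟩ j
    rintro _ ⟨i, rfl⟩
    have := (hlam i).1
    have := sub_pos.2 (hαlam i)
    positivity
  have hsum : Summable S := by
    refine DavisYin.summable_of_forall_mul_le_sub (V := fun k => ‖z k - zstar‖ ^ 2)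
      (c := 2 * (α * τ)) (by positivity) hS0 (fun k => sq_nonneg _) fun k => ?_
    have hl := (hlam k).1
    have hnext : z (k + 1) - zstar = (z k - zstar) - lam k • w k := by
      simp only [hw, hz, DavisYin.relaxedIterate]
      module
    have h1 : α * τ ≤ lam k * (1 - α * lam k) := by
      have := mul_le_mul_of_nonneg_left (hτle k) hα0.le
      rwa [mul_div_cancel₀ _ hα0.ne'] at this
    have h2 := mul_le_mul_of_nonneg_right h1 (hS0 k)
    have h3 := mul_le_mul_of_nonneg_left (hwS k) (sq_nonneg (lam k))
    simp only [hnext]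
    rw [norm_sub_sq_real (z k - zstar), norm_smul, inner_smul_right, Real.norm_eq_abs,
      abs_of_pos hl]
    change _ ≤ _ - (_ - 2 * (lam k * S k) + _)
    linarith
  -- the objective gap is dominated by a multiple of `S`
  set K := 1 / β + 1 / (4 * βf) + 1 / (2 * βf) with hK
  have hK0 : 0 ≤ K := by positivity
  have hgap : ∀ i, (DavisYin.objective f g h (xg i) - DavisYin.objective f g h xstar).toReal
      ≤ (2 / γ + K * (2 * α)) * S i := by
    intro i
    have hwi : xg i - xf i = w i := (hwx i).symm
    have h1 := DavisYin.le_add_inner_gradient_add hf_diff hf_lip (xf i) (xg i)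
    have h2 := DavisYin.add_inner_gradient_le hf_convex hf_diff (xf i) xstar
    have h3 := hg.toReal_add_inner_le (hug i) hgs
    have h4 := DavisYin.add_inner_gradient_le hh_convex hh_diff (xg i) xstar
    have h5 := DavisYin.inner_le_two_mul_inner_add_smul (hwpqr i) hγ0 hβ hβf (hp i) (hq i) (hr i)
    rw [← hza] at h5
    have h6 : inner ℝ (xg i - xstar) (w i) = γ * (inner ℝ (ug i) (xg i - xstar)
        + inner ℝ (gradient f (xf i)) (xg i - xstar)
        + inner ℝ (gradient h (xg i)) (xg i - xstar)) := by
      rw [real_inner_comm, ← inner_add_left, ← inner_add_left]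
      nth_rw 1 [show w i = _ from hwu i]
      rw [inner_smul_left, conj_trivial]
    have h7 : inner ℝ (gradient f (xf i)) (xg i - xf i)
        - inner ℝ (gradient f (xf i)) (xstar - xf i)
        = inner ℝ (gradient f (xf i)) (xg i - xstar) := by
      rw [← inner_sub_right, sub_sub_sub_cancel_right]
    rw [← neg_sub, inner_neg_left, real_inner_comm] at h3
    rw [← neg_sub, inner_neg_right] at h4
    rw [hwi] at h1 h7
    rw [h6, show (2 : ℝ) * inner ℝ (z i - zstar) (w i) = γ * (2 / γ * S i) by
      rw [hS]; field_simp, mul_assoc γ, ← mul_add] at h5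
    have h8 := le_of_mul_le_mul_left h5 hγ0
    have h9 := mul_le_mul_of_nonneg_left (hwS i) hK0
    have h10 : K * ‖w i‖ ^ 2 = (1 / β + 1 / (4 * βf)) * ‖w i‖ ^ 2
        + 1 / βf / 2 * ‖w i‖ ^ 2 := by rw [hK]; ring
    rw [hD]
    linarith
  exact ⟨hgs, hgk, DavisYin.runningMin_nonneg hD0, DavisYin.runningMin_isLittleO hD0
    (Summable.of_nonneg_of_le hD0 hgap (hsum.mul_left _))⟩
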